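/- Let $m,n\ge 0$, $B\ge 1$ and $K\ge 1$ be integers, put $k=\lfloor\log_2 B\rfloor$, and suppose $n\ge Kmk$. The online algorithm $\mathsf{Cool}$ with parameters $K,B$ receives the columns $a_1,\dots,a_n\in\mathbb R^m$ of a matrix $A\in\mathbb R^{m\times n}$ one at a time. It starts from the state $y=0\in\mathbb R^m$. In step $t$, where the temperature is $b_t$, it outputs the value $x_t\in\{-b_t,b_t\}$ that minimizes $\|y+x_ta_t\|_2$ (choosing $-b_t$ in a tie) and replaces $y$ by $y+x_ta_t$. The temperature is $b_t=2^k$ (the largest power of two not exceeding $B$) in the first $n-Kmk$ steps, then $2^{k-1}$ in the next $Km$ steps, then $2^{k-2}$ in the next $Km$ steps, and so on, down to $1$ in the last $Km$ steps. The output is $x=(x_1,\dots,x_n)\in([-B,B]\cap\mathbb Z)^n$. **Theorem.** There are absolute constants $K_0\in\mathbb N$ and $C,c>0$ such that for all integers $K\ge \max(1,K_0)$, $m,n\ge 0$ and $B\ge1$ with $n\ge 2Km\lfloor\log_2 B\rfloor$ (in particular whenever $n\ge 2Km\log_2 B$): if $A$ is an $m\times n$ matrix with independent standard normal entries and $x$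 is the output of $\mathsf{Cool}$ with parameters $K,B$ on $A$, then $$\Pr\left[\frac{\|Ax\|_2}{\|x\|_2}> C\,\frac{m}{B\sqrt n}\right]\le C\,\max(1,\lfloor\log_2 B\rfloor)\,2^{-cm}.$$ (For $n=0$ both sides of the inequality inside the probability are read as $0$.) -/

import Mathlib

open MeasureTheory ProbabilityTheory
open scoped Matrix

noncomputable section

/-- The law of the entries of an `m × n` matrix with independent standard normal entries. -/
def gaussianEntries (m n : ℕ) : Measure (Fin m → Fin n → ℝ) :=
  Measure.pi fun _ : Fin m => Measure.pi fun _ : Fin n => gaussianReal 0 1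

/-- The temperature used in step `t` (steps are numbered `0, …, n - 1`). Write
`k = ⌊log₂ B⌋`, so that `2 ^ k` is the largest power of two that is at most `B`. The temperature
is `2 ^ k` in the first `n - K m k` steps, then `2 ^ (k - 1)` for `K m` steps, then `2 ^ (k - 2)`
for `K m` steps, and so on, down to `1` in the last `K m` steps. -/
def coolTemperature (K m n B t : ℕ) : ℕ :=
  if t < n - K * m * Nat.log 2 B then 2 ^ Nat.log 2 B
  else 2 ^ (Nat.log 2 B - 1 - (t - (n - K * m * Nat.log 2 B)) / (K * m))

/-- One step: in state `y`, at temperature `b`, on sample `a`, the output is whichever of `-b` and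
`b` gives the shorter updated state (with `-b` in case of a tie). -/
def coolChoice {m : ℕ} (b : ℕ) (y a : EuclideanSpace ℝ (Fin m)) : ℤ :=
  open Classical in
  if ‖y - (b : ℝ) • a‖ ≤ ‖y + (b : ℝ) • a‖ then -(b : ℤ) else (b : ℤ)

/-- The state (running sum) after `t` steps, for temperatures `b 0, b 1, …` and
samples `a 0, a 1, …`. -/
def coolState {m : ℕ} (b : ℕ → ℕ) (a : ℕ → EuclideanSpace ℝ (Fin m)) :
    ℕ → EuclideanSpace ℝ (Fin m)
  | 0 => 0
  | t + 1 => coolState b a t + (coolChoice (b t) (coolState b a t) (a t) : ℝ) • a t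

/-- The columns of `A` as a sequence of samples (only the first `n` terms are ever used). -/
def coolSample {m n : ℕ} (A : Matrix (Fin m) (Fin n) ℝ) (t : ℕ) : EuclideanSpace ℝ (Fin m) :=
  if h : t < n then WithLp.toLp 2 fun i => A i ⟨t, h⟩ else 0

/-- The output of the cooling algorithm on the columns of `A`. -/
def coolOutput (K B : ℕ) {m n : ℕ} (A : Matrix (Fin m) (Fin n) ℝ) : Fin n → ℤ := fun t =>
  coolChoice (coolTemperature K m n B t)
    (coolState (coolTemperature K m n B) (coolSample A) t) (coolSample A t)

/-- The Euclidean norm of a real vector. -/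
def norm2 {k : ℕ} (v : Fin k → ℝ) : ℝ := ‖(WithLp.toLp 2 v : EuclideanSpace ℝ (Fin k))‖

end

/-!
While the temperature is `b`, the state `y` of the cooling algorithm is a Markov chain on `ℝ ^ m`:
each step replaces `y` by the shorter of `y - b a` and `y + b a`, for a fresh standard Gaussian
column `a`. Hence `‖y'‖ ^ 2 = ‖y‖ ^ 2 - 2 b |⟪y, a⟫| + b ^ 2 ‖a‖ ^ 2`, so that with `u = y / ‖y‖`
`‖y'‖ / b ≤ ‖y‖ / b - |⟪u, a⟫| + b ‖a‖ ^ 2 / (2 ‖y‖)`.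
Here `⟪u, a⟫` is standard normal, and the last term is about `1 / (2 R)` once `‖y‖` exceeds
`R m b`. Exponentiating gives a geometric drift condition with absolute constants `ρ < 1` and `R`
(`lintegral_expNorm_coolStep_le`): in one step, the expectation of `V y = exp (‖y‖ / b)` becomes at
most `ρ V y + exp ((R + 2) m)`.

Iterating, `N` steps from a state with `‖y‖ ≤ 2 D m b` leave `V` with expectation at most
`ρ ^ N exp (2 D m) + exp ((R + 2) m) / (1 - ρ)`. For `D = R + 3` and `N = K m`, `K` a large
constant, Markov's inequality bounds the probability that the state then has norm more than `D m b`
by a multiple of `exp (-m)`. The assumption `‖y‖ ≤ 2 D m b` is what the previous phase, at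
temperature `2 b`, provides, and the first phase starts from `y = 0`; so the failure probabilities
add up over the `⌊log₂ B⌋ + 1` phases (`stateLaw_farSet_le`), and at the end, at temperature `1`,
`‖A x‖ ≤ D m` with the required probability. The bound on the ratio follows because `‖x‖` is at
least `B √n / 3` whatever `A` is: at least half of the steps are made at a temperature above `B / 2`
(`norm2_coolOutput_ge`).

The phases are analysed through the laws of the states: `stepLaw` maps the law before a step to the
law after it, and `stateLaw_succ` is the independence of a column from the state it is added to.
-/

open scoped ENNReal

noncomputable section

/-! ### Gaussian integrals -/

theorem lintegral_exp_mul_sq_gaussianReal_le {s : ℝ} (hs0 : 0 ≤ s) (hs : s ≤ 1 / 4) :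
    ∫⁻ x, ENNReal.ofReal (Real.exp (s * x ^ 2)) ∂(gaussianReal 0 1)
      ≤ ENNReal.ofReal (Real.exp (2 * s)) := by
  have hpdf : ∀ x : ℝ, gaussianPDFReal 0 1 x * Real.exp (s * x ^ 2)
      = (√(2 * Real.pi))⁻¹ * Real.exp (-(1 / 2 - s) * x ^ 2) := by
    intro x
    rw [gaussianPDFReal_def]
    simp only [NNReal.coe_one, mul_one, sub_zero]
    rw [mul_assoc, ← Real.exp_add]
    ring_nf
  have h1 : ∫⁻ x, ENNReal.ofReal (Real.exp (s * x ^ 2)) ∂(gaussianReal 0 1)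
      = ∫⁻ x, ENNReal.ofReal ((√(2 * Real.pi))⁻¹ * Real.exp (-(1 / 2 - s) * x ^ 2)) := by
    rw [gaussianReal_of_var_ne_zero 0 one_ne_zero,
      lintegral_withDensity_eq_lintegral_mul _ (measurable_gaussianPDF 0 1) (by fun_prop)]
    refine lintegral_congr fun x => ?_
    rw [Pi.mul_apply, gaussianPDF_def, ← ENNReal.ofReal_mul (gaussianPDFReal_nonneg _ _ _), hpdf]
  rw [h1, ← ofReal_integral_eq_lintegral_ofReal
    ((integrable_exp_neg_mul_sq (by linarith)).const_mul _)
    (ae_of_all _ fun x => by positivity), integral_const_mul, integral_gaussian]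
  refine ENNReal.ofReal_le_ofReal ?_
  have hq : (0 : ℝ) < 1 - 2 * s := by linarith
  have hE : (1 - 2 * s)⁻¹ ≤ Real.exp (2 * s) ^ 2 := by
    have h2 := Real.add_one_le_exp (2 * s)
    have h3 : (1 + 2 * s) ^ 2 ≤ Real.exp (2 * s) ^ 2 := by
      gcongr; linarith
    refine le_trans ?_ h3
    rw [inv_le_iff_one_le_mul₀ hq]
    nlinarith [mul_nonneg hs0 hs0, mul_nonneg hs0 (sub_nonneg.2 hs),
      mul_nonneg (mul_nonneg hs0 hs0) (sub_nonneg.2 hs)]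
  rw [← Real.sqrt_inv, ← Real.sqrt_mul (by positivity)]
  refine Real.sqrt_le_iff.2 ⟨(Real.exp_pos _).le, le_trans (le_of_eq ?_) hE⟩
  have : (1 / 2 - s) ≠ 0 := by linarith
  have := Real.pi_ne_zero
  field_simp

theorem lintegral_exp_mul_norm_sq_stdGaussian_le {m : ℕ} {s : ℝ} (hs0 : 0 ≤ s) (hs : s ≤ 1 / 4) :
    ∫⁻ a, ENNReal.ofReal (Real.exp (s * ‖a‖ ^ 2)) ∂(stdGaussian (EuclideanSpace ℝ (Fin m)))
      ≤ ENNReal.ofReal (Real.exp (2 * s * m)) := by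
  rw [← map_pi_eq_stdGaussian, lintegral_map (by fun_prop) (by fun_prop)]
  have h1 : ∀ x : Fin m → ℝ, ENNReal.ofReal (Real.exp (s * ‖WithLp.toLp 2 x‖ ^ 2))
      = ∏ i, ENNReal.ofReal (Real.exp (s * x i ^ 2)) := by
    intro x
    rw [EuclideanSpace.real_norm_sq_eq, Finset.mul_sum, Real.exp_sum,
      ENNReal.ofReal_prod_of_nonneg fun _ _ => (Real.exp_pos _).le]
  simp_rw [h1]
  have hind : iIndepFun (fun (i : Fin m) (x : Fin m → ℝ) => ENNReal.ofReal (Real.exp (s * x i ^ 2)))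
      (Measure.pi fun _ : Fin m => gaussianReal 0 1) :=
    iIndepFun_pi (X := fun _ x => ENNReal.ofReal (Real.exp (s * x ^ 2)))
      fun i => Measurable.aemeasurable (by fun_prop)
  rw [lintegral_prod_eq_prod_lintegral_of_indepFun _ _ hind (fun i => by fun_prop)]
  have h2 : ∀ i : Fin m, ∫⁻ x : Fin m → ℝ, ENNReal.ofReal (Real.exp (s * x i ^ 2))
      ∂(Measure.pi fun _ : Fin m => gaussianReal 0 1) ≤ ENNReal.ofReal (Real.exp (2 * s)) := by
    intro i
    rw [(measurePreserving_eval (fun _ : Fin m => gaussianReal 0 1) i).lintegral_comp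
      (f := fun x => ENNReal.ofReal (Real.exp (s * x ^ 2))) (by fun_prop)]
    exact lintegral_exp_mul_sq_gaussianReal_le hs0 hs
  refine (Finset.prod_le_prod' fun i _ => h2 i).trans (le_of_eq ?_)
  rw [Finset.prod_const, Finset.card_univ, Fintype.card_fin,
    ← ENNReal.ofReal_pow (Real.exp_pos _).le, ← Real.exp_nat_mul]
  ring_nf

theorem lintegral_exp_neg_abs_gaussianReal_lt_one :
    ∫⁻ x, ENNReal.ofReal (Real.exp (-|x|)) ∂(gaussianReal 0 1) < 1 := by
  have hint : Integrable (fun x : ℝ => Real.exp (-|x|)) (gaussianReal 0 1) :=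
    Integrable.of_bound (C := 1) (Measurable.aestronglyMeasurable (by fun_prop))
      (ae_of_all _ fun x => by
        rw [Real.norm_eq_abs, abs_of_pos (Real.exp_pos _)]
        exact Real.exp_le_one_iff.2 (by simp))
  rw [← ofReal_integral_eq_lintegral_ofReal hint (ae_of_all _ fun x => (Real.exp_pos _).le),
    ENNReal.ofReal_lt_one]
  have : NullSingletonClass (gaussianReal 0 1) := nullSingletonClass_gaussianReal one_ne_zero
  have hpos : 0 < ∫ x, (1 - Real.exp (-|x|)) ∂(gaussianReal 0 1) := by
    rw [integral_pos_iff_support_of_nonneg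
      (fun x => sub_nonneg.2 (Real.exp_le_one_iff.2 (by simp)))
      ((integrable_const 1).sub hint)]
    have hsub : ({0}ᶜ : Set ℝ) ⊆ Function.support fun x : ℝ => 1 - Real.exp (-|x|) := by
      intro x hx
      have : Real.exp (-|x|) < 1 := by simpa using hx
      exact (sub_pos.2 this).ne'
    refine lt_of_lt_of_le ?_ (measure_mono hsub)
    rw [measure_compl (measurableSet_singleton 0) (measure_ne_top _ _)]
    simp
  rw [integral_sub (integrable_const 1) hint] at hpos
  simp at hpos
  exact hpos

theorem map_inner_stdGaussian {E : Type*} [NormedAddCommGroup E] [InnerProductSpace ℝ E]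
    [FiniteDimensional ℝ E] [MeasurableSpace E] [BorelSpace E] {u : E} (hu : ‖u‖ = 1) :
    (stdGaussian E).map (fun a => inner ℝ u a) = gaussianReal 0 1 := by
  have h := IsGaussian.map_eq_gaussianReal (μ := stdGaussian E) (innerSL ℝ u)
  rw [integral_strongDual_stdGaussian, variance_dual_stdGaussian] at h
  simpa [hu] using h

/-- The columns of the matrix are independent with independent standard normal entries, although
`gaussianEntries` is defined row by row. -/
theorem map_swap_gaussianEntries (m n : ℕ) :
    (gaussianEntries m n).map (fun a j i => a i j)
      = Measure.pi fun _ : Fin n => Measure.pi fun _ : Fin m => gaussianReal 0 1 := by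
  have key : ∀ p q : ℕ, (Measure.pi fun _ : Fin p => Measure.pi fun _ : Fin q => gaussianReal 0 1)
      = (Measure.pi fun _ : Fin p × Fin q => gaussianReal 0 1).map
        (MeasurableEquiv.curry (Fin p) (Fin q) ℝ) := by
    intro p q
    have := Measure.infinitePi_map_curry (fun (_ : Fin p) (_ : Fin q) => gaussianReal 0 1)
    simp only [Measure.infinitePi_eq_pi] at this
    exact this.symm
  have hswap := Measure.map_infinitePi_infinitePi_of_inj
    (P := fun _ : Fin m × Fin n => gaussianReal 0 1) (f := (Prod.swap : Fin n × Fin m → _))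
    Prod.swap_injective
  simp only [Measure.infinitePi_eq_pi] at hswap
  rw [gaussianEntries, key m n, key n m, ← hswap, Measure.map_map (by fun_prop) (by fun_prop),
    Measure.map_map (by fun_prop) (by fun_prop)]
  rfl

/-! ### The drift of one step -/

/-- One update of the state: from `y`, at temperature `b`, on sample `a`. -/
def coolStep {m : ℕ} (b : ℕ) (y a : EuclideanSpace ℝ (Fin m)) : EuclideanSpace ℝ (Fin m) :=
  y + (coolChoice b y a : ℝ) • a

theorem sq_coolChoice {m : ℕ} (b : ℕ) (y a : EuclideanSpace ℝ (Fin m)) :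
    (coolChoice b y a : ℝ) ^ 2 = (b : ℝ) ^ 2 := by
  unfold coolChoice
  split_ifs <;> simp

theorem norm_sq_coolStep {m : ℕ} (b : ℕ) (y a : EuclideanSpace ℝ (Fin m)) :
    ‖coolStep b y a‖ ^ 2 = ‖y‖ ^ 2 - 2 * b * |inner ℝ y a| + (b : ℝ) ^ 2 * ‖a‖ ^ 2 := by
  have hb : (0 : ℝ) ≤ b := b.cast_nonneg
  have hadd : ‖y + (b : ℝ) • a‖ ^ 2 = ‖y‖ ^ 2 + 2 * (b * inner ℝ y a) + (b : ℝ) ^ 2 * ‖a‖ ^ 2 := by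
    rw [norm_add_sq_real, inner_smul_right, norm_smul, mul_pow, Real.norm_eq_abs, sq_abs]
  have hsub : ‖y - (b : ℝ) • a‖ ^ 2 = ‖y‖ ^ 2 - 2 * (b * inner ℝ y a) + (b : ℝ) ^ 2 * ‖a‖ ^ 2 := by
    rw [norm_sub_sq_real, inner_smul_right, norm_smul, mul_pow, Real.norm_eq_abs, sq_abs]
  have hcmp : ‖y - (b : ℝ) • a‖ ≤ ‖y + (b : ℝ) • a‖ ↔ 0 ≤ b * inner ℝ y a := by
    rw [← sq_le_sq₀ (norm_nonneg _) (norm_nonneg _), hadd, hsub]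
    constructor <;> intro h <;> linarith
  have habs : (b : ℝ) * |inner ℝ y a| = |b * inner ℝ y a| := by rw [abs_mul, abs_of_nonneg hb]
  rw [mul_assoc, habs]
  unfold coolStep coolChoice
  split_ifs with h
  · rw [Int.cast_neg, Int.cast_natCast, neg_smul, ← sub_eq_add_neg, hsub,
      abs_of_nonneg (hcmp.1 h)]
  · rw [Int.cast_natCast, hadd, abs_of_neg (not_le.1 fun h' => h (hcmp.2 h'))]
    ring

/-- From `√(r² + s) ≤ r + s / (2 r)`, applied to `norm_sq_coolStep`. -/
theorem norm_coolStep_le_of_pos {m : ℕ} (b : ℕ) {y : EuclideanSpace ℝ (Fin m)} (hy : 0 < ‖y‖)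
    (a : EuclideanSpace ℝ (Fin m)) :
    ‖coolStep b y a‖
      ≤ ‖y‖ - b * |inner ℝ (‖y‖⁻¹ • y) a| + (b : ℝ) ^ 2 * ‖a‖ ^ 2 / (2 * ‖y‖) := by
  have h := norm_sq_coolStep b y a
  have hin : |inner ℝ (‖y‖⁻¹ • y) a| = ‖y‖⁻¹ * |inner ℝ y a| := by
    rw [real_inner_smul_left, abs_mul, abs_of_pos (inv_pos.2 hy)]
  rw [hin]
  have hrhs : ‖y‖ - b * (‖y‖⁻¹ * |inner ℝ y a|) + (b : ℝ) ^ 2 * ‖a‖ ^ 2 / (2 * ‖y‖)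
      = (‖y‖ ^ 2 + ‖coolStep b y a‖ ^ 2) / (2 * ‖y‖) := by
    rw [h]; field_simp; ring
  rw [hrhs, le_div_iff₀ (by positivity)]
  nlinarith [sq_nonneg (‖y‖ - ‖coolStep b y a‖)]

theorem norm_coolStep_le {m : ℕ} (b : ℕ) (y a : EuclideanSpace ℝ (Fin m)) :
    ‖coolStep b y a‖ ≤ ‖y‖ + b * ‖a‖ := by
  refine (norm_add_le _ _).trans ?_
  rw [norm_smul]
  have h : ‖(coolChoice b y a : ℝ)‖ = b := by
    rw [Real.norm_eq_abs, ← abs_of_nonneg (b.cast_nonneg : (0 : ℝ) ≤ b)]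
    exact sq_eq_sq_iff_abs_eq_abs _ _ |>.1 (sq_coolChoice b y a)
  rw [h]

theorem measurable_coolChoice {m : ℕ} (b : ℕ) :
    Measurable fun p : EuclideanSpace ℝ (Fin m) × EuclideanSpace ℝ (Fin m) =>
      (coolChoice b p.1 p.2 : ℝ) := by
  have h : (fun p : EuclideanSpace ℝ (Fin m) × EuclideanSpace ℝ (Fin m) =>
      (coolChoice b p.1 p.2 : ℝ))
      = {p | ‖p.1 - (b : ℝ) • p.2‖ ≤ ‖p.1 + (b : ℝ) • p.2‖}.indicator (fun _ => -(2 * b : ℝ))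
        + fun _ => (b : ℝ) := by
    ext p
    simp only [coolChoice, Pi.add_apply, Set.indicator_apply, Set.mem_ofPred_eq]
    split_ifs
    · push_cast; ring
    · simp
  rw [h]
  exact (measurable_const.indicator (measurableSet_le (by fun_prop) (by fun_prop))).add
    measurable_const

theorem measurable_coolStep {m : ℕ} (b : ℕ) :
    Measurable fun p : EuclideanSpace ℝ (Fin m) × EuclideanSpace ℝ (Fin m) =>
      coolStep b p.1 p.2 :=
  measurable_fst.add ((measurable_coolChoice b).smul measurable_snd)

/-- The Lyapunov function `exp (‖y‖ / b)` of the walk at temperature `b`. -/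
def expNorm {m : ℕ} (b : ℕ) (y : EuclideanSpace ℝ (Fin m)) : ℝ≥0∞ :=
  ENNReal.ofReal (Real.exp (‖y‖ / b))

theorem measurable_expNorm {m : ℕ} (b : ℕ) :
    Measurable (expNorm b : EuclideanSpace ℝ (Fin m) → ℝ≥0∞) := by
  unfold expNorm; fun_prop

theorem lintegral_expNorm_coolStep_le_of_norm_le {m b : ℕ} (hm : 0 < m) (hb : 0 < b) {R : ℝ}
    {y : EuclideanSpace ℝ (Fin m)} (hy : ‖y‖ ≤ R * m * b) :
    ∫⁻ a, expNorm b (coolStep b y a) ∂(stdGaussian (EuclideanSpace ℝ (Fin m)))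
      ≤ ENNReal.ofReal (Real.exp ((R + 2) * m)) := by
  have hb' : (0 : ℝ) < b := by exact_mod_cast hb
  have hm' : (1 : ℝ) ≤ m := by exact_mod_cast hm
  have hpt : ∀ a : EuclideanSpace ℝ (Fin m), expNorm b (coolStep b y a)
      ≤ ENNReal.ofReal (Real.exp (R * m + 1)) * ENNReal.ofReal (Real.exp (1 / 4 * ‖a‖ ^ 2)) := by
    intro a
    rw [expNorm, ← ENNReal.ofReal_mul (Real.exp_pos _).le, ← Real.exp_add]
    refine ENNReal.ofReal_le_ofReal (Real.exp_le_exp.2 ?_)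
    rw [div_le_iff₀ hb']
    -- This form of the bound on `‖a‖` makes a coefficient `1 / 4` of `‖a‖ ^ 2` suffice.
    have h1 : ‖a‖ ≤ 1 + 1 / 4 * ‖a‖ ^ 2 := by nlinarith [sq_nonneg (‖a‖ - 2)]
    have h2 := norm_coolStep_le b y a
    nlinarith
  refine (lintegral_mono hpt).trans ?_
  rw [lintegral_const_mul _ (by fun_prop)]
  refine (mul_le_mul_right (lintegral_exp_mul_norm_sq_stdGaussian_le
    (by norm_num) le_rfl) _).trans ?_
  rw [← ENNReal.ofReal_mul (Real.exp_pos _).le, ← Real.exp_add]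
  refine ENNReal.ofReal_le_ofReal (Real.exp_le_exp.2 ?_)
  nlinarith

/-- The contraction away from the origin. The hypothesis on `ρ` comes from `e⁻ᵍ w ≤ e⁻ᵍ + w - 1`
for `g ≥ 0` and `w ≥ 1`, which makes Hölder's inequality unnecessary. -/
theorem lintegral_expNorm_coolStep_le_of_lt_norm {m b : ℕ} (hm : 0 < m) (hb : 0 < b) {R : ℝ}
    (hR : 2 ≤ R) {ρ : ℝ≥0∞}
    (hρ : ∫⁻ x, ENNReal.ofReal (Real.exp (-|x|)) ∂(gaussianReal 0 1)
      + ENNReal.ofReal (Real.exp R⁻¹) ≤ ρ + 1)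
    {y : EuclideanSpace ℝ (Fin m)} (hy : R * m * b < ‖y‖) :
    ∫⁻ a, expNorm b (coolStep b y a) ∂(stdGaussian (EuclideanSpace ℝ (Fin m)))
      ≤ ρ * expNorm b y := by
  have hb' : (0 : ℝ) < b := by exact_mod_cast hb
  have hm' : (1 : ℝ) ≤ m := by exact_mod_cast hm
  have hR0 : 0 < R := by linarith
  have hy0 : 0 < ‖y‖ := lt_trans (by positivity) hy
  set γ := stdGaussian (EuclideanSpace ℝ (Fin m))
  set u : EuclideanSpace ℝ (Fin m) := ‖y‖⁻¹ • y with hu_def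
  have hu : ‖u‖ = 1 := by
    rw [hu_def, norm_smul, norm_inv, norm_norm, inv_mul_cancel₀ hy0.ne']
  set s : ℝ := (2 * R * m)⁻¹ with hs_def
  have hs0 : 0 ≤ s := by positivity
  have hs4 : s ≤ 1 / 4 := by
    rw [hs_def, inv_le_comm₀ (by positivity) (by norm_num)]
    nlinarith
  set X : EuclideanSpace ℝ (Fin m) → ℝ≥0∞ := fun a => ENNReal.ofReal (Real.exp (-|inner ℝ u a|))
  set W : EuclideanSpace ℝ (Fin m) → ℝ≥0∞ := fun a => ENNReal.ofReal (Real.exp (s * ‖a‖ ^ 2))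
  have hX : Measurable X := by fun_prop
  have hW : Measurable W := by fun_prop
  have hpt : ∀ a, expNorm b (coolStep b y a) ≤ expNorm b y * (X a * W a) := by
    intro a
    simp only [expNorm, X, W]
    rw [← ENNReal.ofReal_mul (Real.exp_pos _).le, ← ENNReal.ofReal_mul (Real.exp_pos _).le,
      ← Real.exp_add, ← Real.exp_add]
    refine ENNReal.ofReal_le_ofReal (Real.exp_le_exp.2 ?_)
    rw [div_le_iff₀ hb']
    refine (norm_coolStep_le_of_pos b hy0 a).trans ?_
    have h1 : (b : ℝ) ^ 2 * ‖a‖ ^ 2 / (2 * ‖y‖) ≤ s * ‖a‖ ^ 2 * b := by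
      rw [div_le_iff₀ (by positivity)]
      have h2 : (b : ℝ) ≤ s * (2 * ‖y‖) := by
        rw [hs_def, inv_mul_eq_div, le_div_iff₀ (by positivity)]
        nlinarith
      have h3 : (0 : ℝ) ≤ ‖a‖ ^ 2 * b := by positivity
      nlinarith [mul_le_mul_of_nonneg_left h2 h3]
    have h4 : (‖y‖ / b + (-|inner ℝ u a| + s * ‖a‖ ^ 2)) * b
        = ‖y‖ - b * |inner ℝ u a| + s * ‖a‖ ^ 2 * b := by
      field_simp; ring
    rw [h4]
    linarith
  -- Since `X ≤ 1 ≤ W`, the product satisfies `X W + 1 ≤ X + W`.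
  have hXW : ∀ a, X a * W a + 1 ≤ X a + W a := by
    intro a
    simp only [X, W]
    have hx : Real.exp (-|inner ℝ u a|) ≤ 1 := Real.exp_le_one_iff.2 (by simp)
    have hw : 1 ≤ Real.exp (s * ‖a‖ ^ 2) := Real.one_le_exp (by positivity)
    rw [← ENNReal.ofReal_mul (Real.exp_pos _).le, ← ENNReal.ofReal_one,
      ← ENNReal.ofReal_add (by positivity) zero_le_one,
      ← ENNReal.ofReal_add (by positivity) (by positivity)]
    refine ENNReal.ofReal_le_ofReal ?_
    nlinarith [mul_nonneg (sub_nonneg.2 hx) (sub_nonneg.2 hw)]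
  have hIX : ∫⁻ a, X a ∂γ = ∫⁻ x, ENNReal.ofReal (Real.exp (-|x|)) ∂(gaussianReal 0 1) := by
    rw [← map_inner_stdGaussian hu, lintegral_map (by fun_prop) (by fun_prop)]
  have hIW : ∫⁻ a, W a ∂γ ≤ ENNReal.ofReal (Real.exp R⁻¹) := by
    refine (lintegral_exp_mul_norm_sq_stdGaussian_le hs0 hs4).trans (le_of_eq ?_)
    rw [hs_def]
    congr 2
    field_simp
  have hI : ∫⁻ a, X a * W a ∂γ ≤ ρ := by
    have h1 : ∫⁻ a, X a * W a ∂γ + 1 ≤ ρ + 1 := by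
      calc ∫⁻ a, X a * W a ∂γ + 1 = ∫⁻ a, (X a * W a + 1) ∂γ := by
            rw [lintegral_add_right _ measurable_const]; simp
        _ ≤ ∫⁻ a, (X a + W a) ∂γ := lintegral_mono hXW
        _ = ∫⁻ a, X a ∂γ + ∫⁻ a, W a ∂γ := lintegral_add_left hX _
        _ ≤ ρ + 1 := le_trans (by rw [hIX]; gcongr) hρ
    exact (ENNReal.add_le_add_iff_right ENNReal.one_ne_top).1 h1
  calc ∫⁻ a, expNorm b (coolStep b y a) ∂γ ≤ ∫⁻ a, expNorm b y * (X a * W a) ∂γ :=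
        lintegral_mono hpt
    _ = expNorm b y * ∫⁻ a, X a * W a ∂γ := lintegral_const_mul _ (hX.mul hW)
    _ ≤ expNorm b y * ρ := by gcongr
    _ = ρ * expNorm b y := mul_comm _ _

/-- The drift condition for the chain at temperature `b`, uniformly in `b` and `m`. -/
theorem lintegral_expNorm_coolStep_le {m b : ℕ} (hm : 0 < m) (hb : 0 < b) {R : ℝ}
    (hR : 2 ≤ R) {ρ : ℝ≥0∞}
    (hρ : ∫⁻ x, ENNReal.ofReal (Real.exp (-|x|)) ∂(gaussianReal 0 1)
      + ENNReal.ofReal (Real.exp R⁻¹) ≤ ρ + 1)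
    (y : EuclideanSpace ℝ (Fin m)) :
    ∫⁻ a, expNorm b (coolStep b y a) ∂(stdGaussian (EuclideanSpace ℝ (Fin m)))
      ≤ ρ * expNorm b y + ENNReal.ofReal (Real.exp ((R + 2) * m)) := by
  rcases le_or_gt ‖y‖ (R * m * b) with h | h
  · exact (lintegral_expNorm_coolStep_le_of_norm_le hm hb h).trans le_add_self
  · exact (lintegral_expNorm_coolStep_le_of_lt_norm hm hb hR hρ h).trans le_self_add

/-- There are a contraction factor `ρ < 1` and a radius `R` as in `lintegral_expNorm_coolStep_le`:
the expectation of `exp (-|g|)` is less than `1`, and `exp R⁻¹` is close to `1` for large `R`. -/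
theorem exists_contraction_constants :
    ∃ ρ R : ℝ, 0 ≤ ρ ∧ ρ < 1 ∧ 2 ≤ R ∧
      ∫⁻ x, ENNReal.ofReal (Real.exp (-|x|)) ∂(gaussianReal 0 1) + ENNReal.ofReal (Real.exp R⁻¹)
        ≤ ENNReal.ofReal ρ + 1 := by
  set I := ∫⁻ x, ENNReal.ofReal (Real.exp (-|x|)) ∂(gaussianReal 0 1) with hI
  have hI1 : I < 1 := lintegral_exp_neg_abs_gaussianReal_lt_one
  have hr : I.toReal < 1 := by
    simpa using (ENNReal.toReal_lt_toReal hI1.ne_top ENNReal.one_ne_top).2 hI1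
  have hr0 : 0 ≤ I.toReal := ENNReal.toReal_nonneg
  have hlim : Filter.Tendsto (fun R : ℝ => Real.exp R⁻¹) Filter.atTop (nhds 1) := by
    have := (Real.continuous_exp.tendsto 0).comp tendsto_inv_atTop_zero
    simpa [Function.comp_def] using this
  obtain ⟨R, hRe, hR⟩ := ((hlim.eventually (gt_mem_nhds
    (show (1 : ℝ) < 1 + (1 - I.toReal) / 2 by linarith))).and
    (Filter.eventually_ge_atTop 2)).exists
  refine ⟨(1 + I.toReal) / 2, R, by linarith, by linarith, hR, ?_⟩
  nth_rewrite 1 [← ENNReal.ofReal_toReal hI1.ne_top]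
  rw [← ENNReal.ofReal_one,
    ← ENNReal.ofReal_add hr0 (Real.exp_pos _).le, ← ENNReal.ofReal_add (by linarith) zero_le_one]
  exact ENNReal.ofReal_le_ofReal (by linarith)

/-! ### The evolution of the law at a fixed temperature -/

section Laws

variable {m : ℕ}

/-- The law of the state after one step at temperature `b` on an independent standard Gaussian
sample, when `ν` is the law of the state before the step. -/
def stepLaw {m : ℕ} (b : ℕ) (ν : Measure (EuclideanSpace ℝ (Fin m))) :
    Measure (EuclideanSpace ℝ (Fin m)) :=
  (ν.prod (stdGaussian (EuclideanSpace ℝ (Fin m)))).map fun p => coolStep b p.1 p.2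

instance isFiniteMeasure_iterate_stepLaw (b N : ℕ) (ν : Measure (EuclideanSpace ℝ (Fin m)))
    [IsFiniteMeasure ν] : IsFiniteMeasure ((stepLaw b)^[N] ν) := by
  induction N with
  | zero => simpa
  | succ N ih => rw [Function.iterate_succ_apply', stepLaw]; infer_instance

theorem iterate_stepLaw_univ (b N : ℕ) (ν : Measure (EuclideanSpace ℝ (Fin m)))
    [IsFiniteMeasure ν] : ((stepLaw b)^[N] ν) Set.univ = ν Set.univ := by
  induction N with
  | zero => simp
  | succ N ih =>
    rw [Function.iterate_succ_apply', stepLaw,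
      Measure.map_apply (measurable_coolStep b) MeasurableSet.univ, Set.preimage_univ,
      Measure.prod_apply MeasurableSet.univ]
    simp [ih]

theorem iterate_stepLaw_add (b N : ℕ) (ν ν' : Measure (EuclideanSpace ℝ (Fin m)))
    [IsFiniteMeasure ν] [IsFiniteMeasure ν'] :
    (stepLaw b)^[N] (ν + ν') = (stepLaw b)^[N] ν + (stepLaw b)^[N] ν' := by
  induction N with
  | zero => simp
  | succ N ih =>
    simp only [Function.iterate_succ_apply', ih]
    simp only [stepLaw]
    rw [Measure.add_prod, Measure.map_add _ _ (measurable_coolStep b)]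

/-- Iterating the drift inequality: `N` steps contract the expectation of the Lyapunov function
by `ρ ^ N`, up to the fixed point `L` of the affine recursion. -/
theorem lintegral_expNorm_iterate_stepLaw_le {b : ℕ} {ρ M L : ℝ≥0∞}
    (hstep : ∀ y : EuclideanSpace ℝ (Fin m),
      ∫⁻ a, expNorm b (coolStep b y a) ∂(stdGaussian (EuclideanSpace ℝ (Fin m)))
        ≤ ρ * expNorm b y + M)
    (hL : ρ * L + M ≤ L) (N : ℕ) (ν : Measure (EuclideanSpace ℝ (Fin m))) [IsFiniteMeasure ν] :
    ∫⁻ y, expNorm b y ∂((stepLaw b)^[N] ν)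
      ≤ ρ ^ N * ∫⁻ y, expNorm b y ∂ν + L * ν Set.univ := by
  induction N with
  | zero => simp
  | succ N ih =>
    have hmeas : Measurable fun p : EuclideanSpace ℝ (Fin m) × EuclideanSpace ℝ (Fin m) =>
        expNorm b (coolStep b p.1 p.2) := (measurable_expNorm b).comp (measurable_coolStep b)
    rw [Function.iterate_succ_apply']
    nth_rewrite 1 [stepLaw]
    rw [lintegral_map (measurable_expNorm b) (measurable_coolStep b),
      lintegral_prod _ hmeas.aemeasurable]
    calc ∫⁻ y, ∫⁻ a, expNorm b (coolStep b y a) ∂(stdGaussian (EuclideanSpace ℝ (Fin m)))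
          ∂((stepLaw b)^[N] ν)
        ≤ ∫⁻ y, (ρ * expNorm b y + M) ∂((stepLaw b)^[N] ν) := lintegral_mono hstep
      _ = ρ * ∫⁻ y, expNorm b y ∂((stepLaw b)^[N] ν) + M * ν Set.univ := by
        rw [lintegral_add_right _ measurable_const, lintegral_const_mul _ (measurable_expNorm b),
          lintegral_const, iterate_stepLaw_univ]
      _ ≤ ρ * (ρ ^ N * ∫⁻ y, expNorm b y ∂ν + L * ν Set.univ) + M * ν Set.univ := by gcongr
      _ = ρ ^ (N + 1) * ∫⁻ y, expNorm b y ∂ν + (ρ * L + M) * ν Set.univ := by ring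
      _ ≤ ρ ^ (N + 1) * ∫⁻ y, expNorm b y ∂ν + L * ν Set.univ := by gcongr

/-- The states of norm more than `r`. -/
def farSet (m : ℕ) (r : ℝ) : Set (EuclideanSpace ℝ (Fin m)) := {y | r < ‖y‖}

theorem measurableSet_farSet (r : ℝ) : MeasurableSet (farSet m r) :=
  measurableSet_lt measurable_const measurable_norm

theorem measure_farSet_le {b : ℕ} (hb : 0 < b) (D : ℝ)
    (ν : Measure (EuclideanSpace ℝ (Fin m))) :
    ν (farSet m (D * b)) ≤ ENNReal.ofReal (Real.exp (-D)) * ∫⁻ y, expNorm b y ∂ν := by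
  have hb' : (0 : ℝ) < b := by exact_mod_cast hb
  have h1 : ENNReal.ofReal (Real.exp D) * ν (farSet m (D * b)) ≤ ∫⁻ y, expNorm b y ∂ν := by
    refine le_trans ?_ (mul_meas_ge_le_lintegral (measurable_expNorm b)
      (ENNReal.ofReal (Real.exp D)))
    gcongr
    intro y (hy : D * b < ‖y‖)
    exact ENNReal.ofReal_le_ofReal (Real.exp_le_exp.2 ((le_div_iff₀ hb').2 hy.le))
  calc ν (farSet m (D * b))
      = ENNReal.ofReal (Real.exp (-D)) * (ENNReal.ofReal (Real.exp D) * ν (farSet m (D * b))) := by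
        rw [← mul_assoc, ← ENNReal.ofReal_mul (Real.exp_pos _).le, ← Real.exp_add]
        simp
    _ ≤ _ := by gcongr

/-- If the state has law `ν`, then after `N` steps at temperature `b` it is outside the ball of
radius `D b` only if it started outside the ball of radius `D' b`, up to a probability controlled by
Markov's inequality. The two cases are separated by splitting `ν`, on which the chain acts
linearly. -/
theorem iterate_stepLaw_farSet_le {b : ℕ} (hb : 0 < b) {ρ M L : ℝ≥0∞}
    (hstep : ∀ y : EuclideanSpace ℝ (Fin m),
      ∫⁻ a, expNorm b (coolStep b y a) ∂(stdGaussian (EuclideanSpace ℝ (Fin m)))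
        ≤ ρ * expNorm b y + M)
    (hL : ρ * L + M ≤ L) (N : ℕ) (D D' : ℝ)
    (ν : Measure (EuclideanSpace ℝ (Fin m))) [IsProbabilityMeasure ν] :
    ((stepLaw b)^[N] ν) (farSet m (D * b))
      ≤ ν (farSet m (D' * b)) +
        ENNReal.ofReal (Real.exp (-D)) * (ρ ^ N * ENNReal.ofReal (Real.exp D') + L) := by
  have hb' : (0 : ℝ) < b := by exact_mod_cast hb
  set F := farSet m (D' * b)
  have hF : MeasurableSet F := measurableSet_farSet _
  have hsplit : (stepLaw b)^[N] ν
      = (stepLaw b)^[N] (ν.restrict F) + (stepLaw b)^[N] (ν.restrict Fᶜ) := by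
    rw [← iterate_stepLaw_add, Measure.restrict_add_restrict_compl hF]
  rw [hsplit, Measure.add_apply]
  refine add_le_add ?_ ?_
  · refine (measure_mono (Set.subset_univ _)).trans (le_of_eq ?_)
    rw [iterate_stepLaw_univ, Measure.restrict_apply_univ]
  · refine (measure_farSet_le hb D _).trans ?_
    gcongr
    refine (lintegral_expNorm_iterate_stepLaw_le hstep hL N _).trans ?_
    have huniv : (ν.restrict Fᶜ) Set.univ ≤ 1 := by
      rw [Measure.restrict_apply_univ]; exact prob_le_one
    have hint : ∫⁻ y in Fᶜ, expNorm b y ∂ν ≤ ENNReal.ofReal (Real.exp D') := by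
      calc ∫⁻ y in Fᶜ, expNorm b y ∂ν ≤ ∫⁻ _ in Fᶜ, ENNReal.ofReal (Real.exp D') ∂ν := by
            refine setLIntegral_mono' hF.compl fun y hy => ?_
            have hy' : ‖y‖ ≤ D' * b := not_lt.1 hy
            exact ENNReal.ofReal_le_ofReal (Real.exp_le_exp.2 ((div_le_iff₀ hb').2 hy'))
        _ ≤ ENNReal.ofReal (Real.exp D') * 1 := by
            rw [lintegral_const]; gcongr
        _ = _ := mul_one _
    calc ρ ^ N * ∫⁻ y in Fᶜ, expNorm b y ∂ν + L * (ν.restrict Fᶜ) Set.univ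
        ≤ ρ ^ N * ENNReal.ofReal (Real.exp D') + L * 1 := by gcongr
      _ = _ := by rw [mul_one]

/-! ### The state of the algorithm as a Markov chain -/

theorem coolState_succ (b : ℕ → ℕ) (a : ℕ → EuclideanSpace ℝ (Fin m)) (t : ℕ) :
    coolState b a (t + 1) = coolStep (b t) (coolState b a t) (a t) := rfl

/-- The state after `t` steps depends only on the samples before time `t`. -/
theorem coolState_congr (b : ℕ → ℕ) {a a' : ℕ → EuclideanSpace ℝ (Fin m)} {t : ℕ}
    (h : ∀ s < t, a s = a' s) : coolState b a t = coolState b a' t := by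
  induction t with
  | zero => rfl
  | succ t ih =>
    rw [coolState_succ, coolState_succ, ih fun s hs => h s (hs.trans t.lt_succ_self),
      h t t.lt_succ_self]

theorem measurable_coolState {Ω : Type*} [MeasurableSpace Ω] (b : ℕ → ℕ)
    {a : Ω → ℕ → EuclideanSpace ℝ (Fin m)} (ha : ∀ t, Measurable fun ω => a ω t) (t : ℕ) :
    Measurable fun ω => coolState b (a ω) t := by
  induction t with
  | zero => exact measurable_const
  | succ t ih =>
    simp only [coolState_succ]
    exact (measurable_coolStep (b t)).comp (ih.prodMk (ha t))

/-- The law of the state after `t` steps, as a measure on `ℝ ^ m`. -/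
def stateLaw (m n : ℕ) (b : ℕ → ℕ) (t : ℕ) : Measure (EuclideanSpace ℝ (Fin m)) :=
  (gaussianEntries m n).map fun a => coolState b (coolSample (Matrix.of a)) t

instance isProbabilityMeasure_gaussianEntries (m n : ℕ) :
    IsProbabilityMeasure (gaussianEntries m n) := by
  unfold gaussianEntries; infer_instance

theorem measurable_coolSample {n : ℕ} (t : ℕ) :
    Measurable fun a : Fin m → Fin n → ℝ => coolSample (Matrix.of a) t := by
  unfold coolSample
  split_ifs with h
  · simp only [Matrix.of_apply]; fun_prop
  · exact measurable_const

instance isProbabilityMeasure_stateLaw (n : ℕ) (b : ℕ → ℕ) (t : ℕ) :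
    IsProbabilityMeasure (stateLaw m n b t) :=
  Measure.isProbabilityMeasure_map (measurable_coolState b measurable_coolSample t).aemeasurable

theorem map_coolSample {n t : ℕ} (ht : t < n) :
    (gaussianEntries m n).map (fun a => coolSample (Matrix.of a) t)
      = stdGaussian (EuclideanSpace ℝ (Fin m)) := by
  have h : (fun a : Fin m → Fin n → ℝ => coolSample (Matrix.of a) t)
      = WithLp.toLp 2 ∘ (fun c : Fin n → Fin m → ℝ => c ⟨t, ht⟩) ∘ fun a j i => a i j := by
    ext a : 1
    simp [coolSample, ht]
  rw [h, ← Measure.map_map (by fun_prop) (by fun_prop),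
    ← Measure.map_map (by fun_prop) (by fun_prop), map_swap_gaussianEntries,
    (measurePreserving_eval _ _).map_eq, map_pi_eq_stdGaussian]

theorem iIndepFun_coolSample (m n : ℕ) :
    iIndepFun (fun (j : Fin n) (a : Fin m → Fin n → ℝ) => coolSample (Matrix.of a) j)
      (gaussianEntries m n) := by
  rw [iIndepFun_iff_map_fun_eq_pi_map fun j => (measurable_coolSample _).aemeasurable]
  simp only [map_coolSample (Fin.is_lt _)]
  have h : (fun (a : Fin m → Fin n → ℝ) (j : Fin n) => coolSample (Matrix.of a) j)
      = (fun (c : Fin n → Fin m → ℝ) j => WithLp.toLp 2 (c j)) ∘ fun a j i => a i j := by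
    ext a : 2
    simp [coolSample]
  rw [h, ← Measure.map_map (by fun_prop) (by fun_prop), map_swap_gaussianEntries,
    Measure.pi_map_pi (fun _ => Measurable.aemeasurable (by fun_prop))]
  simp only [map_pi_eq_stdGaussian]

theorem indepFun_coolState_coolSample {n t : ℕ} (b : ℕ → ℕ) (ht : t < n) :
    IndepFun (fun a : Fin m → Fin n → ℝ => coolState b (coolSample (Matrix.of a)) t)
      (fun a => coolSample (Matrix.of a) t) (gaussianEntries m n) := by
  classical
  set S : Finset (Fin n) := Finset.univ.filter fun j => (j : ℕ) < t
  set T : Finset (Fin n) := {⟨t, ht⟩}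
  have hST : Disjoint S T := by
    rw [Finset.disjoint_singleton_right]
    simp [S]
  have h := (iIndepFun_coolSample m n).indepFun_finset S T hST fun j => measurable_coolSample _
  -- The state after `t` steps is a function of the samples with index in `S`.
  set φ : (S → EuclideanSpace ℝ (Fin m)) → EuclideanSpace ℝ (Fin m) := fun c =>
    coolState b (fun s => if hs : ∃ h : s < n, (⟨s, h⟩ : Fin n) ∈ S then c ⟨⟨s, hs.1⟩, hs.2⟩ else 0) t
  have hφ : Measurable φ := by
    refine measurable_coolState b (fun s => ?_) t
    split_ifs
    · exact measurable_pi_apply _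
    · exact measurable_const
  have h2 := h.comp hφ (measurable_pi_apply (⟨⟨t, ht⟩, Finset.mem_singleton_self _⟩ : T))
  refine h2.congr (ae_of_all _ fun a => ?_) (ae_of_all _ fun a => rfl)
  refine coolState_congr b fun s hs => ?_
  have hs' : ∃ h : s < n, (⟨s, h⟩ : Fin n) ∈ S := ⟨hs.trans ht, by simp [S, hs]⟩
  simp [hs']

theorem stateLaw_zero (n : ℕ) (b : ℕ → ℕ) : stateLaw m n b 0 = Measure.dirac 0 := by
  simp [stateLaw, coolState]

/-- The Markov property of the state. -/
theorem stateLaw_succ {n t : ℕ} (b : ℕ → ℕ) (ht : t < n) :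
    stateLaw m n b (t + 1) = stepLaw (b t) (stateLaw m n b t) := by
  have hs := measurable_coolState b (measurable_coolSample (m := m) (n := n)) t
  rw [stepLaw, ← map_coolSample ht, stateLaw, stateLaw,
    ← (indepFun_coolState_coolSample b ht).map_prod_eq_prod_map_map hs.aemeasurable
      (measurable_coolSample t).aemeasurable,
    Measure.map_map (measurable_coolStep _) (hs.prodMk (measurable_coolSample t))]
  rfl

theorem stateLaw_add {n t N b₀ : ℕ} (b : ℕ → ℕ) (hn : t + N ≤ n)
    (hb : ∀ s, t ≤ s → s < t + N → b s = b₀) :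
    stateLaw m n b (t + N) = (stepLaw b₀)^[N] (stateLaw m n b t) := by
  induction N with
  | zero => rfl
  | succ N ih =>
    rw [← add_assoc, stateLaw_succ b (by omega), hb (t + N) (by omega) (by omega),
      ih (by omega) fun s h1 h2 => hb s h1 (by omega), Function.iterate_succ_apply']

end Laws

/-! ### The output and the cooling schedule -/

theorem norm2_mulVec_coolOutput {K B m n : ℕ} (A : Matrix (Fin m) (Fin n) ℝ) :
    norm2 (A *ᵥ fun j => (coolOutput K B A j : ℝ))
      = ‖coolState (coolTemperature K m n B) (coolSample A) n‖ := by
  set b := coolTemperature K m n B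
  have h : ∀ t, coolState b (coolSample A) t
      = ∑ s ∈ Finset.range t, (coolChoice (b s) (coolState b (coolSample A) s) (coolSample A s) : ℝ)
        • coolSample A s := by
    intro t
    induction t with
    | zero => rfl
    | succ t ih =>
      rw [Finset.sum_range_succ, ← ih]
      rfl
  rw [norm2]
  congr 1
  rw [h n, Finset.sum_range]
  ext i
  simp [Matrix.mulVec, dotProduct, coolOutput, coolSample, mul_comm, b]

theorem coolTemperature_of_lt {K m n B t : ℕ} (ht : t < n - K * m * Nat.log 2 B) :
    coolTemperature K m n B t = 2 ^ Nat.log 2 B := if_pos ht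

theorem coolTemperature_of_mem_phase {K m n B j t : ℕ}
    (h1 : n - K * m * Nat.log 2 B + j * (K * m) ≤ t)
    (h2 : t < n - K * m * Nat.log 2 B + j * (K * m) + K * m) :
    coolTemperature K m n B t = 2 ^ (Nat.log 2 B - (j + 1)) := by
  have hdiv : (t - (n - K * m * Nat.log 2 B)) / (K * m) = j := by
    refine Nat.div_eq_of_lt_le (by omega) ?_
    rw [Nat.succ_mul]
    omega
  rw [coolTemperature, if_neg (by omega), hdiv, Nat.sub_sub, add_comm 1 j]

/-- At least half of the steps are made at the top temperature, which exceeds `B / 2`. -/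
theorem norm2_coolOutput_ge {K B m n : ℕ} (hB : 1 ≤ B) (hn : 2 * K * m * Nat.log 2 B ≤ n)
    (A : Matrix (Fin m) (Fin n) ℝ) :
    B * √n / 3 ≤ norm2 (fun j => (coolOutput K B A j : ℝ)) := by
  rw [norm2]
  refine le_of_sq_le_sq ?_ (norm_nonneg _)
  rw [EuclideanSpace.real_norm_sq_eq]
  set k := Nat.log 2 B
  set τ := n - K * m * k
  have hτ : (n : ℝ) ≤ 2 * τ := by
    have : n ≤ 2 * τ := by
      have h : 2 * K * m * k = 2 * (K * m * k) := by ring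
      omega
    exact_mod_cast this
  have hBk : (B : ℝ) ≤ 2 * 2 ^ k := by
    have h := (Nat.lt_pow_succ_log_self (b := 2) one_lt_two B).le
    rw [pow_succ'] at h
    exact_mod_cast h
  have hsum : (τ : ℝ) * (2 ^ k) ^ 2 ≤ ∑ j : Fin n, (coolOutput K B A j : ℝ) ^ 2 := by
    have h1 : ∀ j : Fin n, (coolOutput K B A j : ℝ) ^ 2
        = (coolTemperature K m n B j : ℝ) ^ 2 := fun j => sq_coolChoice _ _ _
    simp only [h1]
    rw [← Finset.sum_range fun t => (coolTemperature K m n B t : ℝ) ^ 2]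
    calc (τ : ℝ) * (2 ^ k) ^ 2 = ∑ t ∈ Finset.range τ, (coolTemperature K m n B t : ℝ) ^ 2 := by
          rw [Finset.sum_congr rfl fun t ht => by
            rw [coolTemperature_of_lt (Finset.mem_range.1 ht)]]
          simp [k]
      _ ≤ _ := Finset.sum_le_sum_of_subset_of_nonneg
          (Finset.range_subset_range.2 (Nat.sub_le _ _)) fun _ _ _ => by positivity
  refine le_trans ?_ hsum
  rw [div_pow, mul_pow, Real.sq_sqrt n.cast_nonneg]
  have hB2 : (B : ℝ) ^ 2 ≤ 4 * (2 ^ k) ^ 2 := by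
    have : (B : ℝ) ^ 2 ≤ (2 * 2 ^ k) ^ 2 := by gcongr
    linarith [mul_pow (2 : ℝ) (2 ^ k) 2]
  have := mul_le_mul hB2 hτ n.cast_nonneg (by positivity)
  nlinarith [show (0 : ℝ) ≤ τ * (2 ^ k) ^ 2 by positivity]

/-- The Markov term of `iterate_stepLaw_farSet_le`, in the scaling of the cooling schedule. -/
theorem markov_term_le {ρ R D' : ℝ} {m N : ℕ} (hρ : 0 ≤ ρ) (hρ1 : ρ < 1)
    (hN : ρ ^ N * Real.exp D' ≤ Real.exp ((R + 2) * m)) :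
    ENNReal.ofReal (Real.exp (-((R + 3) * m))) * (ENNReal.ofReal ρ ^ N * ENNReal.ofReal (Real.exp D')
        + ENNReal.ofReal (Real.exp ((R + 2) * m) / (1 - ρ)))
      ≤ ENNReal.ofReal ((1 + (1 - ρ)⁻¹) * Real.exp (-m)) := by
  have h1 : 0 < 1 - ρ := by linarith
  rw [← ENNReal.ofReal_pow hρ, ← ENNReal.ofReal_mul (by positivity),
    ← ENNReal.ofReal_add (by positivity) (by positivity), ← ENNReal.ofReal_mul (by positivity)]
  refine ENNReal.ofReal_le_ofReal ?_
  have he : Real.exp (-m) = Real.exp (-((R + 3) * m)) * Real.exp ((R + 2) * m) := by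
    rw [← Real.exp_add]; ring_nf
  rw [he, div_eq_mul_inv]
  nlinarith [mul_le_mul_of_nonneg_left hN (Real.exp_pos (-((R + 3) * m))).le]

/-- After the phase at temperature `2 ^ (⌊log₂ B⌋ - j)`, the state has norm at most `(R + 3) m` times
that temperature, except with a probability that grows linearly in the number of phases. -/
theorem stateLaw_farSet_le {ρ R : ℝ} (hρ0 : 0 ≤ ρ) (hρ1 : ρ < 1) (hR : 2 ≤ R)
    (hρ : ∫⁻ x, ENNReal.ofReal (Real.exp (-|x|)) ∂(gaussianReal 0 1)
      + ENNReal.ofReal (Real.exp R⁻¹) ≤ ENNReal.ofReal ρ + 1)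
    {K m n B : ℕ} (hm : 0 < m) (hK : ρ ^ K ≤ Real.exp (-(R + 4)))
    (hn : K * m * Nat.log 2 B ≤ n) {j : ℕ} (hj : j ≤ Nat.log 2 B) :
    stateLaw m n (coolTemperature K m n B) (n - K * m * Nat.log 2 B + j * (K * m))
        (farSet m ((R + 3) * m * (2 ^ (Nat.log 2 B - j) : ℕ)))
      ≤ (j + 1) * ENNReal.ofReal ((1 + (1 - ρ)⁻¹) * Real.exp (-m)) := by
  set k := Nat.log 2 B
  have h1ρ : 0 < 1 - ρ := by linarith
  have hstep : ∀ b : ℕ, 0 < b → ∀ y : EuclideanSpace ℝ (Fin m),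
      ∫⁻ a, expNorm b (coolStep b y a) ∂(stdGaussian (EuclideanSpace ℝ (Fin m)))
        ≤ ENNReal.ofReal ρ * expNorm b y + ENNReal.ofReal (Real.exp ((R + 2) * m)) :=
    fun b hb y => lintegral_expNorm_coolStep_le hm hb hR hρ y
  have hL : ENNReal.ofReal ρ * ENNReal.ofReal (Real.exp ((R + 2) * m) / (1 - ρ))
      + ENNReal.ofReal (Real.exp ((R + 2) * m))
        ≤ ENNReal.ofReal (Real.exp ((R + 2) * m) / (1 - ρ)) := by
    rw [← ENNReal.ofReal_mul hρ0, ← ENNReal.ofReal_add (by positivity) (by positivity)]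
    refine ENNReal.ofReal_le_ofReal (le_of_eq ?_)
    field_simp
    ring
  induction j with
  | zero =>
    have hrun := stateLaw_add (m := m) (n := n) (t := 0) (N := n - K * m * k) (b₀ := 2 ^ k)
      (coolTemperature K m n B) (by omega) fun s _ hs => coolTemperature_of_lt (hs.trans_eq (zero_add _))
    rw [zero_add, stateLaw_zero] at hrun
    rw [zero_mul, add_zero, hrun, Nat.sub_zero, Nat.cast_zero, zero_add, one_mul]
    have h := iterate_stepLaw_farSet_le (pow_pos two_pos k) (hstep (2 ^ k) (pow_pos two_pos k)) hL
      (n - K * m * k) ((R + 3) * m) 0 (Measure.dirac (0 : EuclideanSpace ℝ (Fin m)))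
    have h0 : Measure.dirac (0 : EuclideanSpace ℝ (Fin m)) (farSet m (0 * (2 ^ k : ℕ))) = 0 := by
      rw [Measure.dirac_apply' _ (measurableSet_farSet _)]
      simp [farSet]
    rw [h0, zero_add] at h
    refine h.trans (markov_term_le hρ0 hρ1 ?_)
    rw [Real.exp_zero, mul_one]
    exact (pow_le_one₀ hρ0 hρ1.le).trans (Real.one_le_exp (by positivity))
  | succ j ih =>
    have hend : n - K * m * k + j * (K * m) + K * m ≤ n := by
      have h1 : j * (K * m) + K * m ≤ K * m * k := by
        calc j * (K * m) + K * m = K * m * (j + 1) := by ring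
          _ ≤ K * m * k := Nat.mul_le_mul_left _ hj
      omega
    have hrun := stateLaw_add (m := m) (coolTemperature K m n B) hend
      fun s h1 h2 => coolTemperature_of_mem_phase h1 h2
    have htime : n - K * m * k + (j + 1) * (K * m) = n - K * m * k + j * (K * m) + K * m := by ring
    rw [htime, hrun]
    refine (iterate_stepLaw_farSet_le (pow_pos two_pos _) (hstep _ (pow_pos two_pos _)) hL
      (K * m) ((R + 3) * m) (2 * ((R + 3) * m)) _).trans ?_
    -- The target radius of the previous phase is the permitted starting radius of this one.
    have htemp : 2 * ((R + 3) * m) * (2 ^ (k - (j + 1)) : ℕ)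
        = (R + 3) * m * (2 ^ (k - j) : ℕ) := by
      rw [show k - j = k - (j + 1) + 1 by omega, pow_succ]
      push_cast
      ring
    rw [htemp, Nat.cast_add_one, add_mul (j + 1 : ℝ≥0∞), one_mul]
    refine add_le_add (ih (by omega)) (markov_term_le hρ0 hρ1 ?_)
    calc ρ ^ (K * m) * Real.exp (2 * ((R + 3) * m))
        ≤ Real.exp (-(R + 4)) ^ m * Real.exp (2 * ((R + 3) * m)) := by
          rw [pow_mul]; gcongr
      _ = Real.exp ((R + 2) * m) := by
          rw [← Real.exp_nat_mul, ← Real.exp_add]; ring_nf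

end

theorem theorem4p1 :
    ∃ (K₀ : ℕ) (C c : ℝ), 0 < C ∧ 0 < c ∧
      ∀ K : ℕ, K₀ ≤ K → ∀ m n B : ℕ, 1 ≤ B → 2 * K * m * Nat.log 2 B ≤ n →
        (gaussianEntries m n).real
            {a : Fin m → Fin n → ℝ | C * ((m : ℝ) / ((B : ℝ) * √(n : ℝ))) <
              norm2 (Matrix.of a *ᵥ fun j => (coolOutput K B (Matrix.of a) j : ℝ)) /
                norm2 (fun j => (coolOutput K B (Matrix.of a) j : ℝ))}
          ≤ C * max 1 (Nat.log 2 B : ℝ) * (2 : ℝ) ^ (-(c * (m : ℝ))) := by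
  obtain ⟨ρ, R, hρ0, hρ1, hR, hρ⟩ := exists_contraction_constants
  obtain ⟨K₀, hK₀⟩ := exists_pow_lt_of_lt_one (Real.exp_pos (-(R + 4))) hρ1
  have h1ρ : 0 < 1 - ρ := by linarith
  set E : ℝ := 1 + (1 - ρ)⁻¹ with hE_def
  have hE : 0 < E := by positivity
  refine ⟨K₀, 3 * (R + 3) + 2 * E, 1, by positivity, one_pos, fun K hK m n B hB hn => ?_⟩
  set C : ℝ := 3 * (R + 3) + 2 * E with hC_def
  have hC : 0 < C := by positivity
  set k := Nat.log 2 B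
  set b := coolTemperature K m n B
  have hrhs : 0 ≤ C * max 1 (k : ℝ) * (2 : ℝ) ^ (-(1 * (m : ℝ))) := by positivity
  have hevent : ∀ a : Fin m → Fin n → ℝ, C * ((m : ℝ) / ((B : ℝ) * √(n : ℝ))) <
      norm2 (Matrix.of a *ᵥ fun j => (coolOutput K B (Matrix.of a) j : ℝ)) /
        norm2 (fun j => (coolOutput K B (Matrix.of a) j : ℝ)) →
      (R + 3) * m < ‖coolState b (coolSample (Matrix.of a)) n‖ := by
    intro a ha
    rw [norm2_mulVec_coolOutput] at ha
    have hx := norm2_coolOutput_ge hB hn (Matrix.of a)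
    have hpos : 0 < norm2 (fun j => (coolOutput K B (Matrix.of a) j : ℝ)) := by
      refine lt_of_le_of_ne (norm_nonneg _) fun h0 => ?_
      -- Division by zero gives `0`, which is not above a nonnegative threshold.
      rw [← h0, div_zero] at ha
      exact absurd ha (not_lt.2 (by positivity))
    rcases n.eq_zero_or_pos with rfl | hn0
    · -- For `n = 0` the output is the empty vector, whose norm is `0`.
      simp [norm2, Subsingleton.elim (_ : EuclideanSpace ℝ (Fin 0)) 0] at hpos
    have hq : 0 < (B : ℝ) * √n := by
      have : (0 : ℝ) < B := by exact_mod_cast hB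
      positivity
    rw [lt_div_iff₀ hpos] at ha
    refine lt_of_le_of_lt ?_ ha
    calc (R + 3) * m = 3 * (R + 3) * (m / (B * √n)) * (B * √n / 3) := by field_simp
      _ ≤ C * (m / (B * √n)) * norm2 (fun j => (coolOutput K B (Matrix.of a) j : ℝ)) := by
        gcongr
        linarith
  rcases m.eq_zero_or_pos with rfl | hm
  · refine (measureReal_mono (s₂ := ∅) fun a ha => ?_).trans (by rwa [measureReal_empty])
    have := hevent a ha
    simp [Subsingleton.elim (coolState b (coolSample (Matrix.of a)) n) 0] at this
  have hKρ : ρ ^ K ≤ Real.exp (-(R + 4)) := (pow_le_pow_of_le_one hρ0 hρ1.le hK).trans hK₀.le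
  have hn' : K * m * k ≤ n := by
    have h : 2 * K * m * k = 2 * (K * m * k) := by ring
    omega
  have htail := stateLaw_farSet_le hρ0 hρ1 hR hρ hm hKρ hn' (le_refl k)
  have htime : n - K * m * k + k * (K * m) = n := by
    rw [mul_comm k]; omega
  rw [htime, Nat.sub_self, pow_zero, Nat.cast_one, mul_one, stateLaw,
    Measure.map_apply (measurable_coolState b measurable_coolSample n)
      (measurableSet_farSet _)] at htail
  have hle : (gaussianEntries m n).real
      {a : Fin m → Fin n → ℝ | C * ((m : ℝ) / ((B : ℝ) * √(n : ℝ))) <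
        norm2 (Matrix.of a *ᵥ fun j => (coolOutput K B (Matrix.of a) j : ℝ)) /
          norm2 (fun j => (coolOutput K B (Matrix.of a) j : ℝ))}
      ≤ (k + 1) * (E * Real.exp (-m)) := by
    refine ENNReal.toReal_le_of_le_ofReal (by positivity) ((measure_mono hevent).trans ?_)
    refine htail.trans (le_of_eq ?_)
    rw [ENNReal.ofReal_mul (by positivity : (0 : ℝ) ≤ k + 1),
      ENNReal.ofReal_add k.cast_nonneg zero_le_one, ENNReal.ofReal_natCast, ENNReal.ofReal_one]
  have hexp : Real.exp (-m) ≤ (2 : ℝ) ^ (-(1 * (m : ℝ))) := by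
    rw [Real.rpow_def_of_pos two_pos]
    refine Real.exp_le_exp.2 ?_
    have hlog : Real.log 2 ≤ 1 := by linarith [Real.log_two_lt_d9]
    nlinarith [(m.cast_nonneg : (0 : ℝ) ≤ m)]
  have hk : (k : ℝ) + 1 ≤ 2 * max 1 (k : ℝ) := by
    linarith [le_max_left 1 (k : ℝ), le_max_right 1 (k : ℝ)]
  calc _ ≤ ((k : ℝ) + 1) * (E * Real.exp (-m)) := hle
    _ ≤ 2 * max 1 (k : ℝ) * (E * (2 : ℝ) ^ (-(1 * (m : ℝ)))) := by gcongr
    _ = 2 * E * max 1 (k : ℝ) * (2 : ℝ) ^ (-(1 * (m : ℝ))) := by ring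
    _ ≤ C * max 1 (k : ℝ) * (2 : ℝ) ^ (-(1 * (m : ℝ))) := by
      gcongr
      linarith
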